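/- Let $\mathbb{C}$ be a regular category, i.e. a category with finite limits in which every morphism factors as a regular epimorphism followed by a monomorphism and regular epimorphisms are stable under pullback. A relation $R$ on an object $X$ is a subobject $\langle r_1,r_2\rangle\colon R\rightarrowtail X\times X$; $1_X$ is the relation $\langle 1_X,1_X\rangle$, $R^\circ$ is the relation $\langle r_2,r_1\rangle$, and $RR$ is the monomorphic part of the (regular epimorphism, monomorphism) factorization of $\langle r_1\pi_1,r_2\pi_2\rangle\colon R\times_X R\to X\times X$, where $\pi_1,\pi_2$ are the projections of the pullback of $r_2$ and $r_1$. The relation $R$ is reflexive if $1_X\leqslant R$, symmetric if $R^\circ\leqslant R$, transitive if $RR\leqslant R$, and an equivalence relation if it has all three properties. For generalised elements $x,y\colon A\to X$ one writes $(x,y)\in R$ if $\langle x,y\rangle\colon A\to X\times X$ factors through $R$. The category $\mathbb{C}$ is a Mal'tsev category if every reflexive relation in $\mathbb{C}$ is an equivalence relation. The following conditions are equivalent: (i) $\mathbb{C}$ is a Mal'tsev category; (ii) the Shifting Lemma holds in $\mathbb{C}$ when $R$ and $T$ are reflexive relations and $S$ is an equivalence relation, that is: for every object $X$ of $\mathbb{C}$,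 all reflexive relations $R$, $T$ on $X$ and every equivalence relation $S$ on $X$ with $R\wedge S\leqslant T$, and for all objects $A$ and all generalised elements $x,y,u,v\colon A\to X$ with $(x,y)\in R\wedge T$, $(x,u)\in S$, $(y,v)\in S$ and $(u,v)\in R$, one has $(u,v)\in T$. -/

import Mathlib

open CategoryTheory Limits

universe v u

namespace InternalRelation

variable {C : Type u} [Category.{v} C] [Regular C]

/-- An internal relation from `X` to `Y` is a subobject of `X ⨯ Y`. -/
abbrev Rel (X Y : C) : Type (max u v) := Subobject (X ⨯ Y)

/-- The first leg `r₁` of a relation `⟨r₁, r₂⟩ : R ↣ X ⨯ Y`. -/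
noncomputable abbrev leg₁ {X Y : C} (R : Rel X Y) : (R : C) ⟶ X := R.arrow ≫ prod.fst

/-- The second leg `r₂` of a relation `⟨r₁, r₂⟩ : R ↣ X ⨯ Y`. -/
noncomputable abbrev leg₂ {X Y : C} (R : Rel X Y) : (R : C) ⟶ Y := R.arrow ≫ prod.snd

theorem legs_ext {X Y A : C} (R : Rel X Y) {f g : A ⟶ (R : C)}
    (h₁ : f ≫ leg₁ R = g ≫ leg₁ R) (h₂ : f ≫ leg₂ R = g ≫ leg₂ R) : f = g := by
  rw [← cancel_mono R.arrow]
  ext <;> simpa using by assumption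

instance {X Y : C} (R : Rel X Y) : Mono (prod.lift (leg₂ R) (leg₁ R)) where
  right_cancellation f g h := by
    have h₁ := congrArg (· ≫ prod.fst) h
    have h₂ := congrArg (· ≫ prod.snd) h
    simp only [Category.assoc, prod.lift_fst, prod.lift_snd] at h₁ h₂
    exact legs_ext R (by simpa using h₂) (by simpa using h₁)

/-- The identity relation `⟨1, 1⟩ : X ↣ X ⨯ X`. -/
noncomputable def idRel (X : C) : Rel X X := Subobject.mk (prod.lift (𝟙 X) (𝟙 X))

/-- The opposite relation, the subobject `⟨r₂, r₁⟩ : R ↣ Y ⨯ X`. -/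
noncomputable def opp {X Y : C} (R : Rel X Y) : Rel Y X :=
  Subobject.mk (prod.lift (leg₂ R) (leg₁ R))

/-- The composite (first `R`, then `S`): the image of `⟨r₁ π₁, s₂ π₂⟩` defined on the pullback of
`r₂` and `s₁`. In a regular category the image is the monomorphic part of the (regular epimorphism,
monomorphism) factorization. -/
noncomputable def comp {X Y Z : C} (R : Rel X Y) (S : Rel Y Z) : Rel X Z :=
  imageSubobject (prod.lift (pullback.fst (leg₂ R) (leg₁ S) ≫ leg₁ R)
    (pullback.snd (leg₂ R) (leg₁ S) ≫ leg₂ S))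

def IsReflexive {X : C} (R : Rel X X) : Prop := idRel X ≤ R

def IsSymmetric {X : C} (R : Rel X X) : Prop := opp R ≤ R

def IsTransitive {X : C} (R : Rel X X) : Prop := comp R R ≤ R

/-- Internal equivalence relations. -/
structure IsEquivalence {X : C} (R : Rel X X) : Prop where
  refl : IsReflexive R
  symm : IsSymmetric R
  trans : IsTransitive R

/-- `(x, y) ∈ R` for generalised elements `x : A ⟶ X` and `y : A ⟶ Y`: the morphism
`⟨x, y⟩ : A ⟶ X ⨯ Y` factors through the subobject `R`. -/
def Mem {X Y A : C} (x : A ⟶ X) (y : A ⟶ Y) (R : Rel X Y) : Prop :=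
  R.Factors (prod.lift x y)

/-- The Shifting Lemma for the relations `R`, `S`, `T` on `X`, read with generalised elements:
if `R ∧ S ≤ T`, then for all `x`, `y`, `u`, `v` with `(x, y) ∈ R ∧ T`, `(x, u) ∈ S`, `(y, v) ∈ S`
and `(u, v) ∈ R`, one has `(u, v) ∈ T`. -/
def ShiftingLemma {X : C} (R S T : Rel X X) : Prop :=
  R ⊓ S ≤ T → ∀ ⦃A : C⦄ (x y u v : A ⟶ X),
    Mem x y (R ⊓ T) → Mem x u S → Mem y v S → Mem u v R → Mem u v T

variable (C) in
/-- Every reflexive relation is an equivalence relation. -/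
def IsMaltsev : Prop :=
  ∀ ⦃X : C⦄ (R : Rel X X), IsReflexive R → IsEquivalence R

end InternalRelation

/-!
In a Mal'tsev category, `y (R ∧ T) x S u`. The composite of `R ∧ T` and `S` is reflexive, hence
symmetric, so `u (R ∧ T) w S y` for some `w` defined after pulling back along a regular epimorphism.
Then `w` and `v` are related by `R` (through `u`) and by `S` (through `y`), hence by `T`, and
`u T v` through `w`.

Conversely, let `E` be any relation with `x₁ E y₁`, `x₂ E y₁` and `x₂ E y₂`. With `S` the kernel
pair of the first leg of `E`, the Shifting Lemma on the object `E` replaces `(x₂, y₁)` by `(x₂, y₂)`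
and yields `x₁ E y₂`. So every relation is difunctional, and a reflexive difunctional relation is an
equivalence relation.
-/

namespace InternalRelation

section Factorization

variable {C : Type u} [Category.{v} C]

theorem factors_of_strongEpi_comp {X A B : C} {P : Subobject X} {h : A ⟶ X} (e : B ⟶ A)
    [StrongEpi e] (he : P.Factors (e ≫ h)) : P.Factors h := by
  have sq : CommSq (P.factorThru _ he) e P.arrow h := ⟨P.factorThru_arrow _ he⟩
  rw [← sq.fac_right]
  exact Subobject.factors_comp_arrow _

theorem eq_prod_lift_iff {X Y A : C} [HasBinaryProduct X Y] {h : A ⟶ X ⨯ Y}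
    {x : A ⟶ X} {y : A ⟶ Y} :
    h = prod.lift x y ↔ h ≫ prod.fst = x ∧ h ≫ prod.snd = y := by
  rw [Limits.prod.hom_ext_iff, prod.lift_fst, prod.lift_snd]

end Factorization

variable {C : Type u} [Category.{v} C] [Regular C]

theorem imageSubobject_factors_iff {W X A : C} {p : W ⟶ X} {h : A ⟶ X} :
    (imageSubobject p).Factors h ↔
      ∃ (B : C) (e : B ⟶ A) (_ : IsRegularEpi e) (k : B ⟶ W), k ≫ p = e ≫ h := by
  constructor
  · intro hp
    have : StrongEpi (factorThruImageSubobject p) := by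
      unfold factorThruImageSubobject
      infer_instance
    let f := (imageSubobject p).factorThru h hp
    refine ⟨_, pullback.fst f (factorThruImageSubobject p), inferInstance,
      pullback.snd f (factorThruImageSubobject p), ?_⟩
    calc pullback.snd f (factorThruImageSubobject p) ≫ p
        = (pullback.snd f _ ≫ factorThruImageSubobject p) ≫ (imageSubobject p).arrow := by
          rw [Category.assoc, imageSubobject_arrow_comp]
      _ = pullback.fst f _ ≫ f ≫ (imageSubobject p).arrow := by
          rw [← pullback.condition, Category.assoc]
      _ = pullback.fst f _ ≫ h := by rw [Subobject.factorThru_arrow]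
  · rintro ⟨B, e, _, k, hk⟩
    exact factors_of_strongEpi_comp e (hk ▸ imageSubobject_factors_comp_self (f := p) k)

section Membership

variable {X Y Z A : C}

theorem Mem.mono {x : A ⟶ X} {y : A ⟶ Y} {R S : Rel X Y} (h : Mem x y R) (hRS : R ≤ S) :
    Mem x y S :=
  Subobject.factors_of_le _ hRS h

theorem Mem.precomp {B : C} {x : A ⟶ X} {y : A ⟶ Y} {R : Rel X Y} (h : Mem x y R)
    (f : B ⟶ A) : Mem (f ≫ x) (f ≫ y) R := by
  rw [Mem, ← prod.comp_lift]
  exact Subobject.factors_of_factors_right f h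

theorem Mem.of_precomp {B : C} {x : A ⟶ X} {y : A ⟶ Y} {R : Rel X Y} (e : B ⟶ A)
    [StrongEpi e] (h : Mem (e ≫ x) (e ≫ y) R) : Mem x y R := by
  rw [Mem, ← prod.comp_lift] at h
  exact factors_of_strongEpi_comp e h

theorem mem_mk_iff {M : C} {i : M ⟶ X ⨯ Y} [Mono i] {x : A ⟶ X} {y : A ⟶ Y} :
    Mem x y (Subobject.mk i) ↔ ∃ k : A ⟶ M, k ≫ i ≫ prod.fst = x ∧ k ≫ i ≫ prod.snd = y := by
  simp only [← Category.assoc, ← eq_prod_lift_iff]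
  exact Subobject.mk_factors_iff i _

theorem mem_iff_exists_hom {x : A ⟶ X} {y : A ⟶ Y} {R : Rel X Y} :
    Mem x y R ↔ ∃ k : A ⟶ (R : C), k ≫ leg₁ R = x ∧ k ≫ leg₂ R = y := by
  rw [← mem_mk_iff, Subobject.mk_arrow]

theorem mem_legs (R : Rel X Y) : Mem (leg₁ R) (leg₂ R) R :=
  mem_iff_exists_hom.2 ⟨𝟙 _, Category.id_comp _, Category.id_comp _⟩

theorem le_iff_forall_mem {R S : Rel X Y} :
    R ≤ S ↔ ∀ ⦃A : C⦄ (x : A ⟶ X) (y : A ⟶ Y), Mem x y R → Mem x y S := by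
  refine ⟨fun h A x y hxy => hxy.mono h, fun h => Subobject.le_of_factors ?_⟩
  rw [(eq_prod_lift_iff (h := R.arrow)).2 ⟨rfl, rfl⟩]
  exact h _ _ (mem_legs R)

theorem mem_inf_iff {x : A ⟶ X} {y : A ⟶ Y} {R S : Rel X Y} :
    Mem x y (R ⊓ S) ↔ Mem x y R ∧ Mem x y S :=
  Subobject.inf_factors _

theorem mem_idRel_iff {x y : A ⟶ X} : Mem x y (idRel X) ↔ x = y := by
  simp only [idRel, mem_mk_iff, prod.lift_fst, prod.lift_snd, Category.comp_id]
  exact ⟨fun ⟨_, hx, hy⟩ => hx.symm.trans hy, fun h => ⟨x, rfl, h⟩⟩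

theorem mem_opp_iff {x : A ⟶ X} {y : A ⟶ Y} {R : Rel X Y} : Mem y x (opp R) ↔ Mem x y R := by
  simp only [opp, mem_mk_iff, prod.lift_fst, prod.lift_snd, mem_iff_exists_hom (R := R), and_comm]

theorem mem_comp_iff {x : A ⟶ X} {z : A ⟶ Z} {R : Rel X Y} {S : Rel Y Z} :
    Mem x z (comp R S) ↔ ∃ (B : C) (e : B ⟶ A) (_ : IsRegularEpi e) (y : B ⟶ Y),
      Mem (e ≫ x) y R ∧ Mem y (e ≫ z) S := by
  refine imageSubobject_factors_iff.trans
    (exists_congr fun B => exists_congr fun e => exists_congr fun _ => ?_)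
  simp only [prod.comp_lift, eq_prod_lift_iff, prod.lift_fst, prod.lift_snd]
  constructor
  · rintro ⟨k, hx, hz⟩
    refine ⟨k ≫ pullback.fst _ _ ≫ leg₂ R, ?_, ?_⟩
    · rw [← hx]
      exact ((mem_legs R).precomp _).precomp _
    · rw [← hz, pullback.condition]
      exact ((mem_legs S).precomp _).precomp _
  · rintro ⟨y, hR, hS⟩
    obtain ⟨f, hx, hf⟩ := mem_iff_exists_hom.1 hR
    obtain ⟨g, hg, hz⟩ := mem_iff_exists_hom.1 hS
    refine ⟨pullback.lift f g (hf.trans hg.symm), ?_, ?_⟩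
    · rw [pullback.lift_fst_assoc, hx]
    · rw [pullback.lift_snd_assoc, hz]

theorem mem_comp {x : A ⟶ X} {y : A ⟶ Y} {z : A ⟶ Z} {R : Rel X Y} {S : Rel Y Z}
    (hR : Mem x y R) (hS : Mem y z S) : Mem x z (comp R S) :=
  mem_comp_iff.2 ⟨A, 𝟙 A, inferInstance, y, by rwa [Category.id_comp], by rwa [Category.id_comp]⟩

end Membership

section Properties

variable {X : C} {R S : Rel X X}

theorem isReflexive_iff : IsReflexive R ↔ ∀ ⦃A : C⦄ (x : A ⟶ X), Mem x x R :=
  le_iff_forall_mem.trans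
    ⟨fun h _ x => h x x (mem_idRel_iff.2 rfl), fun h _ x _ hxy => mem_idRel_iff.1 hxy ▸ h x⟩

theorem isSymmetric_iff :
    IsSymmetric R ↔ ∀ ⦃A : C⦄ ⦃x y : A ⟶ X⦄, Mem x y R → Mem y x R :=
  le_iff_forall_mem.trans
    ⟨fun h _ x y hxy => h y x (mem_opp_iff.2 hxy), fun h _ _ _ hxy => h (mem_opp_iff.1 hxy)⟩

theorem isTransitive_iff :
    IsTransitive R ↔ ∀ ⦃A : C⦄ ⦃x y z : A ⟶ X⦄, Mem x y R → Mem y z R → Mem x z R := by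
  refine le_iff_forall_mem.trans
    ⟨fun h _ x y z hxy hyz => h x z (mem_comp hxy hyz), fun h A x z hxz => ?_⟩
  obtain ⟨B, e, _, y, hxy, hyz⟩ := mem_comp_iff.1 hxz
  exact (h hxy hyz).of_precomp e

theorem IsReflexive.opp (hR : IsReflexive R) : IsReflexive (opp R) :=
  isReflexive_iff.2 fun _ x => mem_opp_iff.2 (isReflexive_iff.1 hR x)

theorem IsReflexive.comp (hR : IsReflexive R) (hS : IsReflexive S) : IsReflexive (comp R S) :=
  isReflexive_iff.2 fun _ x => mem_comp (isReflexive_iff.1 hR x) (isReflexive_iff.1 hS x)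

end Properties

section InverseImage

variable {X Y X' Y' A : C}

/-- The inverse image of a relation `R` along a pair of morphisms `f` and `g`, relating `x` to `y`
when `R` relates `f x` to `g y`. -/
noncomputable def inverseImage (f : X' ⟶ X) (g : Y' ⟶ Y) (R : Rel X Y) : Rel X' Y' :=
  (Subobject.pullback (prod.map f g)).obj R

theorem mem_inverseImage_iff {f : X' ⟶ X} {g : Y' ⟶ Y} {R : Rel X Y} {x : A ⟶ X'} {y : A ⟶ Y'} :
    Mem x y (inverseImage f g R) ↔ Mem (x ≫ f) (y ≫ g) R := by
  rw [Mem, inverseImage, pullback_factors_iff, prod.lift_map, Mem]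

theorem isReflexive_inverseImage_legs (R : Rel X Y) :
    IsReflexive (inverseImage (leg₁ R) (leg₂ R) R) :=
  isReflexive_iff.2 fun _ x => mem_inverseImage_iff.2 ((mem_legs R).precomp x)

/-- The kernel pair of a morphism, as a relation on its domain. -/
noncomputable def kernelRel (f : X ⟶ Y) : Rel X X := inverseImage f f (idRel Y)

theorem mem_kernelRel_iff {f : X ⟶ Y} {x y : A ⟶ X} : Mem x y (kernelRel f) ↔ x ≫ f = y ≫ f :=
  mem_inverseImage_iff.trans mem_idRel_iff

theorem isEquivalence_kernelRel (f : X ⟶ Y) : IsEquivalence (kernelRel f) where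
  refl := isReflexive_iff.2 fun _ _ => mem_kernelRel_iff.2 rfl
  symm := isSymmetric_iff.2 fun _ _ _ h => mem_kernelRel_iff.2 (mem_kernelRel_iff.1 h).symm
  trans := isTransitive_iff.2 fun _ _ _ _ hxy hyz =>
    mem_kernelRel_iff.2 ((mem_kernelRel_iff.1 hxy).trans (mem_kernelRel_iff.1 hyz))

end InverseImage

section Maltsev

variable {X Y : C}

/-- A relation is difunctional if `R R° R ≤ R`; the condition is read with generalised elements,
which avoids composites. -/
def IsDifunctional (R : Rel X Y) : Prop :=
  ∀ ⦃A : C⦄ ⦃x₁ x₂ : A ⟶ X⦄ ⦃y₁ y₂ : A ⟶ Y⦄,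
    Mem x₁ y₁ R → Mem x₂ y₁ R → Mem x₂ y₂ R → Mem x₁ y₂ R

theorem IsDifunctional.isEquivalence {R : Rel X X} (h : IsDifunctional R) (hR : IsReflexive R) :
    IsEquivalence R where
  refl := hR
  symm := isSymmetric_iff.2 fun _ x y hxy =>
    h (isReflexive_iff.1 hR y) hxy (isReflexive_iff.1 hR x)
  trans := isTransitive_iff.2 fun _ _ y _ hxy hyz => h hxy (isReflexive_iff.1 hR y) hyz

theorem IsMaltsev.shiftingLemma (hC : IsMaltsev C) {R S T : Rel X X} (hR : IsReflexive R)
    (hS : IsReflexive S) (hT : IsReflexive T) : ShiftingLemma R S T := by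
  intro hRST A x y u v hxy hxu hyv huv
  have hRT : IsReflexive (R ⊓ T) := le_inf hR hT
  have hRTS : IsReflexive (comp (R ⊓ T) S) := hRT.comp hS
  replace hR := hC R hR
  replace hS := hC S hS
  replace hT := hC T hT
  have hyx : Mem y x (R ⊓ T) := isSymmetric_iff.1 (hC _ hRT).symm hxy
  have huy : Mem u y (comp (R ⊓ T) S) := isSymmetric_iff.1 (hC _ hRTS).symm (mem_comp hyx hxu)
  obtain ⟨B, e, _, w, huw, hwy⟩ := mem_comp_iff.1 huy
  obtain ⟨huwR, huwT⟩ := mem_inf_iff.1 huw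
  have hwvR : Mem w (e ≫ v) R :=
    isTransitive_iff.1 hR.trans (isSymmetric_iff.1 hR.symm huwR) (huv.precomp e)
  have hwvS : Mem w (e ≫ v) S := isTransitive_iff.1 hS.trans hwy (hyv.precomp e)
  have hwvT : Mem w (e ≫ v) T := (mem_inf_iff.2 ⟨hwvR, hwvS⟩).mono hRST
  exact (isTransitive_iff.1 hT.trans huwT hwvT).of_precomp e

theorem isDifunctional_of_shiftingLemma {E : Rel X Y}
    (h : ∀ R T : Rel (E : C) (E : C), IsReflexive R → IsReflexive T →
      ShiftingLemma R (kernelRel (leg₁ E)) T) : IsDifunctional E := by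
  intro A x₁ x₂ y₁ y₂ h₁₁ h₂₁ h₂₂
  let R : Rel (E : C) (E : C) := inverseImage (leg₁ E) (leg₂ E) E
  let T : Rel (E : C) (E : C) := opp R
  have hR : IsReflexive R := isReflexive_inverseImage_legs E
  have mem_R {B : C} {p q : B ⟶ (E : C)} : Mem p q R ↔ Mem (p ≫ leg₁ E) (q ≫ leg₂ E) E :=
    mem_inverseImage_iff
  have mem_T {B : C} {p q : B ⟶ (E : C)} : Mem p q T ↔ Mem (q ≫ leg₁ E) (p ≫ leg₂ E) E :=
    mem_opp_iff.trans mem_R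
  have kernelRel_le_T : kernelRel (leg₁ E) ≤ T := le_iff_forall_mem.2 fun B p q hpq => by
    rw [mem_T, ← mem_kernelRel_iff.1 hpq]
    exact (mem_legs E).precomp p
  obtain ⟨p, hp₁, hp₂⟩ := mem_iff_exists_hom.1 h₁₁
  obtain ⟨q, hq₁, hq₂⟩ := mem_iff_exists_hom.1 h₂₁
  obtain ⟨r, hr₁, hr₂⟩ := mem_iff_exists_hom.1 h₂₂
  have hqpR : Mem q p R := mem_R.2 (by rwa [hq₁, hp₂])
  have hqpT : Mem q p T := mem_T.2 (by rwa [hp₁, hq₂])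
  have hqr : Mem q r (kernelRel (leg₁ E)) := mem_kernelRel_iff.2 (hq₁.trans hr₁.symm)
  have hpp : Mem p p (kernelRel (leg₁ E)) := mem_kernelRel_iff.2 rfl
  have hrpR : Mem r p R := mem_R.2 (by rwa [hr₁, hp₂])
  have hrpT : Mem r p T := h R T hR hR.opp (inf_le_right.trans kernelRel_le_T) q p r p
    (mem_inf_iff.2 ⟨hqpR, hqpT⟩) hqr hpp hrpR
  rw [← hp₁, ← hr₂]
  exact mem_T.1 hrpT

end Maltsev

end InternalRelation

open InternalRelation in
theorem corollary2p3_general {C : Type u} [Category.{v} C] [Regular C] :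
    List.TFAE [
      IsMaltsev C,
      ∀ (X : C) (R S T : Rel X X), IsReflexive R → IsReflexive S → IsReflexive T →
        ShiftingLemma R S T,
      ∀ (X : C) (R S T : Rel X X), IsReflexive R → IsEquivalence S → IsReflexive T →
        ShiftingLemma R S T,
      ∀ (X Y : C) (f : X ⟶ Y) (R T : Rel X X), IsReflexive R → IsReflexive T →
        ShiftingLemma R (kernelRel f) T,
      ∀ (X Y : C) (R : Rel X Y), IsDifunctional R] := by
  tfae_have 1 → 2 := fun hC _ _ _ _ hR hS hT => hC.shiftingLemma hR hS hT
  tfae_have 2 → 3 := fun h X R S T hR hS hT => h X R S T hR hS.refl hT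
  tfae_have 3 → 4 := fun h X _ f R T hR hT => h X R _ T hR (isEquivalence_kernelRel f) hT
  tfae_have 4 → 5 := fun h _ _ _ => isDifunctional_of_shiftingLemma (h _ _ _)
  tfae_have 5 → 1 := fun h X R hR => (h X X R).isEquivalence hR
  tfae_finish

theorem corollary2p3 {C : Type u} [Category.{v} C] [Regular C] :
    InternalRelation.IsMaltsev C ↔
      ∀ (X : C) (R S T : InternalRelation.Rel X X),
        InternalRelation.IsReflexive R → InternalRelation.IsEquivalence S →
          InternalRelation.IsReflexive T → InternalRelation.ShiftingLemma R S T :=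
  corollary2p3_general.out 0 2
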